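/- Let $(\Omega,\mathcal F,\mathbb P)$ be an atomless probability space (some real random variable has a continuous distribution function under $\mathbb P$), let $L^\infty$ and $L^1$ be taken with respect to $\mathbb P$, with the $\mathbb P$-a.s. order, and let $n\in\mathbb N$. For each $i\in\{1,\dots,n\}$ suppose the following are given. * A probability measure $\mathbb Q_i$ equivalent to $\mathbb P$ whose density $d\mathbb Q_i/d\mathbb P$ has a version that is a simple function. * A $\mathbb Q_i$-consistent risk measure $\rho_i\colon L^\infty\to\mathbb R$, that is: $\rho_i$ is monotone; $\rho_i(X+m)=\rho_i(X)+m$ for $X\in L^\infty$, $m\in\mathbb R$; $\rho_i(0)=0$; and $\rho_i(X)\le\rho_i(Y)$ whenever $\mathbb E_{\mathbb Q_i}[v(X)]\le\mathbb E_{\mathbb Q_i}[v(Y)]$ for all convex nondecreasing $v\colon\mathbb R\to\mathbb R$. Its acceptance set is $\mathcal A_{\rho_i}=\{X\in L^\infty:\rho_i(X)\le 0\}$. * A finite-dimensional subspace $\mathcal S_i\subset L^\infty$ containing a nonzero $Z_i\ge 0$, and a positive linear functional $\mathfrak p_i\colon\mathcal S_i\to\mathbb R$ with $\mathfrak p_i(Z)>0$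 for some $0\le Z\in\mathcal S_i$, such that $\sup\{\mathfrak p_i(Z): Z\in\mathcal S_i,\ X+Z\in\mathcal A_{\rho_i}\}<\infty$ for all $X\in L^\infty$. Define $\eta_i(X)=\inf\{\mathfrak p_i(Z): Z\in\mathcal S_i,\ X-Z\in\mathcal A_{\rho_i}\}\in[-\infty,\infty]$, with $\operatorname{dom}(\eta_i)=\{X\in L^\infty:\eta_i(X)\in\mathbb R\}$, and $\eta(X)=\inf\{\sum_{i=1}^n\eta_i(X_i): X_1,\dots,X_n\in L^\infty,\ \sum_{i=1}^nX_i=X\}$. The asymptotic cone $\mathcal A_{\rho_i}^\infty$ is the set of all norm limits $\lim_k s_kY_k$ in $L^\infty$ with $s_k>0$, $s_k\to0$, $Y_k\in\mathcal A_{\rho_i}$. Call $Z\in L^1$ compatible for $\rho_i$ if $\sup_{X\in L^\infty}(\mathbb E[ZX]-\rho_i(X))<\infty$ and if every $U\in\mathcal A_{\rho_i}^\infty$ with $\mathbb E[ZU]=0$ satisfies $U=0$. Assume there is $Q^*\in L^1$ that is compatible for every $\rho_i$ and satisfies $\mathfrak p_i(Z)=\mathbb E[Q^*Z]$ for all $i$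 and all $Z\in\mathcal S_i$. On $\mathcal M=\sum_{i=1}^n\mathcal S_i$ set $\pi(Z)=\mathbb E[Q^*Z]$. Fix $U_i\in\mathcal S_i$, $i=1,\dots,n$, with $\pi\big(\sum_{i=1}^nU_i\big)=1$. Then for every $X\in\sum_{i=1}^n\operatorname{dom}(\eta_i)$ the value $\eta(X)$ is finite, and there are $N_i\in\mathcal S_i$ and $A_i\in\mathcal A_{\rho_i}$, $i=1,\dots,n$, with $\sum_{i=1}^nN_i\in\ker(\pi)$, such that $$X_i:=A_i+N_i+\eta(X)U_i,\qquad i=1,\dots,n,$$ satisfies $\sum_{i=1}^nX_i=X$ and $\eta(X)=\sum_{i=1}^n\eta_i(X_i)$; that is, $(X_1,\dots,X_n)$ is an optimal allocation of $X$. -/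

import Mathlib

open MeasureTheory ProbabilityTheory Filter Topology
open scoped ENNReal

noncomputable section

namespace RiskSharing

/-- `P` is atomless: some real random variable has a continuous cumulative distribution function
under `P`. -/
def IsAtomless {Ω : Type*} [MeasurableSpace Ω] (P : Measure Ω) : Prop :=
  ∃ Y : Ω → ℝ, Measurable Y ∧ Continuous fun x : ℝ => P.real {ω | Y ω ≤ x}

/-- The density `dQ/dP` has a version which is a simple function. -/
def HasSimpleDensity {Ω : Type*} [MeasurableSpace Ω] (P Q : Measure Ω) : Prop :=
  ∃ f : SimpleFunc Ω ℝ, (fun ω => (Q.rnDeriv P ω).toReal) =ᵐ[P] f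

/-- `L^∞` over `P`, with its essential supremum norm and the `P`-almost-sure order. -/
abbrev Linf {Ω : Type*} [MeasurableSpace Ω] (P : Measure Ω) : Type _ := Lp ℝ ∞ P

/-- The effective domain: the points at which an extended-real function is finite. -/
def dom {T : Type*} (f : T → EReal) : Set T := {x | ∃ r : ℝ, f x = (r : EReal)}

section RiskMeasures

variable {Ω : Type*} [MeasurableSpace Ω] {P : Measure Ω}

/-- Monetary risk measures on `L^∞` (arguments are losses): monotone and cash-additive. -/
structure IsMonetaryRiskMeasure [IsProbabilityMeasure P] (ρ : Linf P → ℝ) : Prop where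
  monotone : ∀ X Y : Linf P, X ≤ Y → ρ X ≤ ρ Y
  cash_additive : ∀ (X : Linf P) (m : ℝ), ρ (X + Lp.const ∞ P m) = ρ X + m

/-- The acceptance set of `ρ`. -/
def acceptanceSet (ρ : Linf P → ℝ) : Set (Linf P) := {X | ρ X ≤ 0}

/-- `Y` dominates `X` in second-order stochastic dominance under `Q`. The expectations exist for
`Q ≪ P`, since convex functions on the line are continuous and `X`, `Y` are bounded. -/
def SSDominates (Q : Measure Ω) (Y X : Linf P) : Prop :=
  ∀ v : ℝ → ℝ, ConvexOn ℝ Set.univ v → Monotone v → ∫ ω, v (X ω) ∂Q ≤ ∫ ω, v (Y ω) ∂Q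

/-- `Q`-consistent risk measures: normalised monetary risk measures that respect second-order
stochastic dominance under `Q`. -/
structure IsConsistentRiskMeasure [IsProbabilityMeasure P] (Q : Measure Ω) (ρ : Linf P → ℝ) : Prop where
  monetary : IsMonetaryRiskMeasure ρ
  normalised : ρ 0 = 0
  consistent : ∀ X Y : Linf P, SSDominates Q Y X → ρ X ≤ ρ Y

/-- The convex conjugate on the topological dual of `L^∞`. -/
def conjugate (ρ : Linf P → ℝ) (φ : Linf P →L[ℝ] ℝ) : EReal :=
  ⨆ X : Linf P, ((φ X - ρ X : ℝ) : EReal)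

/-- The functional `X ↦ E[Z X]` on `L^∞` induced by `Z ∈ L^1`. -/
def densityFunctional (Z : Lp ℝ 1 P) : Linf P →L[ℝ] ℝ :=
  (ContinuousLinearMap.mul ℝ ℝ).lpPairing P 1 ∞ Z

theorem densityFunctional_apply (Z : Lp ℝ 1 P) (X : Linf P) :
    densityFunctional Z X = ∫ ω, Z ω * X ω ∂P := by
  simp [densityFunctional, ContinuousLinearMap.lpPairing_eq_integral]

/-- The asymptotic cone of a subset of `L^∞`. -/
def asymptoticCone (A : Set (Linf P)) : Set (Linf P) :=
  {U | ∃ (s : ℕ → ℝ) (Y : ℕ → Linf P), (∀ k, 0 < s k) ∧ (∀ k, Y k ∈ A) ∧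
    Tendsto s atTop (𝓝 0) ∧ Tendsto (fun k => s k • Y k) atTop (𝓝 U)}

/-- The set of all `Z ∈ L^1` that are compatible for `ρ`. -/
def compatibleSet (ρ : Linf P → ℝ) : Set (Lp ℝ 1 P) :=
  {Z | conjugate ρ (densityFunctional Z) < ⊤ ∧
    ∀ U ∈ asymptoticCone (acceptanceSet ρ), ∫ ω, Z ω * U ω ∂P = 0 → U = 0}

/-- `(A, S, p)` is a risk measurement regime: `S` is a finite-dimensional security space containing
a nontrivial positive security, `p` is a positive linear pricing functional which gives some
positive security a positive price, and the prices of securities `Z` with `X + Z ∈ A` are bounded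
above for every `X`. -/
structure IsRiskMeasurementRegime (A : Set (Linf P)) (S : Submodule ℝ (Linf P))
    (p : S →ₗ[ℝ] ℝ) : Prop where
  finiteDimensional : FiniteDimensional ℝ S
  exists_positive : ∃ Z ∈ S, 0 ≤ Z ∧ Z ≠ 0
  price_nonneg : ∀ Z : S, 0 ≤ (Z : Linf P) → 0 ≤ p Z
  exists_price_pos : ∃ Z : S, 0 ≤ (Z : Linf P) ∧ 0 < p Z
  bounded : ∀ X : Linf P, BddAbove {x : ℝ | ∃ Z : S, X + (Z : Linf P) ∈ A ∧ p Z = x}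

/-- The capital requirement `X ↦ inf {p Z | Z ∈ S, X - Z ∈ A}`, with `inf ∅ = ∞`. -/
def capitalRequirement (A : Set (Linf P)) (S : Submodule ℝ (Linf P)) (p : S →ₗ[ℝ] ℝ)
    (X : Linf P) : EReal :=
  ⨅ (Z : S) (_ : X - (Z : Linf P) ∈ A), ((p Z : ℝ) : EReal)

/-- The set of allocations of `X` among `n` agents. -/
def allocations (n : ℕ) (X : Linf P) : Set (Fin n → Linf P) := {Y | ∑ i, Y i = X}

/-- The infimal convolution of finitely many functions (used for functions that do not take the
value `-∞`, so that all sums are unambiguous). -/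
def infConvolution {n : ℕ} (f : Fin n → Linf P → EReal) (X : Linf P) : EReal :=
  ⨅ Y ∈ allocations n X, ∑ i, f i (Y i)

/-- The global security space, the sum of the individual security spaces. -/
abbrev globalMarket {n : ℕ} (S : Fin n → Submodule ℝ (Linf P)) : Submodule ℝ (Linf P) := ⨆ i, S i

/-- The global pricing functional `Z ↦ E[Q Z]` on the global security space. -/
def globalPrice {n : ℕ} (S : Fin n → Submodule ℝ (Linf P)) (Q : Lp ℝ 1 P) :
    globalMarket S →ₗ[ℝ] ℝ :=
  (densityFunctional Q).toLinearMap.domRestrict (globalMarket S)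

/-- The sum of a vector of securities, as an element of the global security space. -/
def totalSecurity {n : ℕ} {S : Fin n → Submodule ℝ (Linf P)} (N : ∀ i, S i) : globalMarket S :=
  ∑ i, Submodule.inclusion (le_iSup S i) (N i)

theorem coe_totalSecurity {n : ℕ} {S : Fin n → Submodule ℝ (Linf P)} (N : ∀ i, S i) :
    (totalSecurity N : Linf P) = ∑ i, (N i : Linf P) := by
  simp [totalSecurity]

theorem globalPrice_apply {n : ℕ} (S : Fin n → Submodule ℝ (Linf P)) (Q : Lp ℝ 1 P)
    (Z : globalMarket S) : globalPrice S Q Z = ∫ ω, Q ω * (Z : Linf P) ω ∂P := by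
  simp [globalPrice, densityFunctional_apply]

end RiskMeasures

end RiskSharing

end

open RiskSharing

/-!
The proof rests on a compactness argument for approximately comonotone allocations.

The functional `φ` with the compatible density `Qstar` is bounded above on each acceptance set, so
the infimal convolution is finite, and its value `r` is the infimum of the prices `φ Z` over all
securities `Z` in the finite-dimensional global market for which `X - Z` is a sum of acceptable
positions. It suffices to show that this infimum is attained: a minimiser `Z = ∑ Tᵢ` with
`X - Z = ∑ Aᵢ` gives the optimal allocation `Aᵢ + Tᵢ`, and `Nᵢ = Tᵢ - r Uᵢ` has total price zero.

The acceptance sets need not be convex, so compactness has to come from consistency. As the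
densities are simple, they are constant on the cells of suitable finite partitions, and averaging
over such a cell is the same under all reference measures. By Jensen's inequality, averaging on
cells on which the aggregate is almost constant makes every agent better off, at the cost of a small
error in the aggregate. On the resulting finite state space, an allocation minimising a quadratic
objective among those preferred by all agents is comonotone within each set of states having equal
densities, since otherwise a small transfer between two agents would contract both positions
(`exists_comonotone_improvement`). Hence every allocation can be improved to one in which, up to a
small error and among states with equal densities, no position oscillates more than the aggregate
(`exists_improved_allocation`).

Bounded positions with such a control of oscillations, and with aggregates converging in norm, are
totally bounded in `L^∞` (`totallyBounded_of_oscControlled`). A minimising sequence is therefore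
relatively compact after division by one plus its size. Were its size unbounded, nonzero directions
in the asymptotic cones would arise in the limit, each of price zero; compatibility excludes this
(`exists_acceptable_decomposition`).
-/

namespace RiskSharing

/-! ### Comonotone improvement on a finite state space -/

/-- Moving the mass-weighted amount `ε` from the state `c` to the state `c'`: the payoff in `c`
drops by `ε / p c` and the payoff in `c'` rises by `ε / p c'`. -/
noncomputable def transfer {C : Type*} [DecidableEq C] (p : C → ℝ) (ε : ℝ) (c c' : C)
    (r : C → ℝ) : C → ℝ :=
  fun x => r x + ε * ((if x = c' then (p x)⁻¹ else 0) - (if x = c then (p x)⁻¹ else 0))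

/-- Moving two values towards each other while keeping their weighted sum, and without either
passing the other's initial place, decreases the weighted sum of a convex function. -/
lemma _root_.ConvexOn.map_contraction_le {v : ℝ → ℝ} (hv : ConvexOn ℝ Set.univ v) {p q x y ε : ℝ}
    (hp : 0 < p) (hq : 0 < q) (hε : 0 ≤ ε) (hxy : y < x) (hpx : ε * p⁻¹ ≤ x - y)
    (hqx : ε * q⁻¹ ≤ x - y) :
    p * v (x - ε * p⁻¹) + q * v (y + ε * q⁻¹) ≤ p * v x + q * v y := by
  have hd : 0 < x - y := sub_pos.2 hxy
  -- the contracted points as convex combinations of `x` and `y`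
  have key : ∀ m : ℝ, 0 < m → ε * m⁻¹ ≤ x - y → ∃ t : ℝ, 0 ≤ t ∧ t ≤ 1 ∧
      t * (x - y) = ε * m⁻¹ := fun m hm h =>
    ⟨ε * m⁻¹ / (x - y), by positivity, (div_le_one hd).2 h, by field_simp⟩
  obtain ⟨s, hs0, hs1, hs⟩ := key p hp hpx
  obtain ⟨t, ht0, ht1, ht⟩ := key q hq hqx
  have h1 := hv.2 (Set.mem_univ x) (Set.mem_univ y) (sub_nonneg.2 hs1) hs0 (by ring)
  have h2 := hv.2 (Set.mem_univ y) (Set.mem_univ x) (sub_nonneg.2 ht1) ht0 (by ring)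
  simp only [smul_eq_mul] at h1 h2
  rw [show (1 - s) * x + s * y = x - ε * p⁻¹ by rw [← hs]; ring] at h1
  rw [show (1 - t) * y + t * x = y + ε * q⁻¹ by rw [← ht]; ring] at h2
  have hps : p * s = q * t := by
    have e1 : p * s * (x - y) = ε := by rw [mul_assoc, hs]; field_simp
    have e2 : q * t * (x - y) = ε := by rw [mul_assoc, ht]; field_simp
    exact mul_right_cancel₀ hd.ne' (e1.trans e2.symm)
  calc p * v (x - ε * p⁻¹) + q * v (y + ε * q⁻¹)
      ≤ p * ((1 - s) * v x + s * v y) + q * ((1 - t) * v y + t * v x) := by gcongr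
    _ = p * v x + q * v y + (p * s - q * t) * (v y - v x) := by ring
    _ = p * v x + q * v y := by rw [hps]; ring

section Transfer

variable {C : Type*} [Fintype C] [DecidableEq C] {p : C → ℝ} {ε : ℝ} {c c' : C} {r : C → ℝ}

lemma sum_transfer_sub (hc : c ≠ c') (φ : C → ℝ → ℝ) :
    ∑ x, φ x (transfer p ε c c' r x) - ∑ x, φ x (r x) =
      (φ c (r c - ε * (p c)⁻¹) + φ c' (r c' + ε * (p c')⁻¹)) - (φ c (r c) + φ c' (r c')) := by
  rw [← Finset.sum_sub_distrib, Finset.sum_eq_add c c' hc]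
  · simp [transfer, hc, hc.symm]
    rw [← sub_eq_add_neg]
    ring
  · rintro x - ⟨h1, h2⟩
    simp [transfer, h1, h2]
  · simp
  · simp

lemma sum_convex_transfer_le (hp : ∀ x, 0 < p x) (hε : 0 ≤ ε) (hr : r c' < r c)
    (h1 : ε * (p c)⁻¹ ≤ r c - r c') (h2 : ε * (p c')⁻¹ ≤ r c - r c') {d : C → ℝ}
    (hd : 0 ≤ d c) (hdc : d c = d c') {v : ℝ → ℝ} (hv : ConvexOn ℝ Set.univ v) :
    ∑ x, d x * p x * v (transfer p ε c c' r x) ≤ ∑ x, d x * p x * v (r x) := by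
  have hc : c ≠ c' := by rintro rfl; exact lt_irrefl _ hr
  have := sum_transfer_sub (p := p) (ε := ε) (r := r) hc (fun x y => d x * p x * v y)
  have h3 := mul_le_mul_of_nonneg_left (hv.map_contraction_le (hp c) (hp c') hε hr h1 h2) hd
  simp only [← hdc] at this
  linarith

lemma sum_sq_transfer_lt (hp : ∀ x, 0 < p x) (hε : 0 < ε) (hr : r c' < r c)
    (h1 : ε * (p c)⁻¹ ≤ r c - r c') (h2 : ε * (p c')⁻¹ < r c - r c') :
    ∑ x, p x * transfer p ε c c' r x ^ 2 < ∑ x, p x * r x ^ 2 := by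
  have hc : c ≠ c' := by rintro rfl; exact lt_irrefl _ hr
  have := sum_transfer_sub (p := p) (ε := ε) (r := r) hc (fun x y => p x * y ^ 2)
  have e1 : p c * (r c - ε * (p c)⁻¹) ^ 2 = p c * r c ^ 2 - 2 * ε * r c + ε * (ε * (p c)⁻¹) := by
    have := (hp c).ne'
    field_simp
    ring
  have e2 : p c' * (r c' + ε * (p c')⁻¹) ^ 2
      = p c' * r c' ^ 2 + 2 * ε * r c' + ε * (ε * (p c')⁻¹) := by
    have := (hp c').ne'
    field_simp
    ring
  have e3 := mul_le_mul_of_nonneg_left h1 hε.le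
  have e4 := mul_lt_mul_of_pos_left h2 hε
  simp only [e1, e2] at this
  linarith

end Transfer

section Finite

variable {ι C : Type*} [Fintype ι] [Fintype C]

/-- The allocations of the same total which are dominated by `a`, agent by agent, in the convex
order of the agent's own weights `d i c * p c`. -/
def convexlyDominated (p : C → ℝ) (d a : ι → C → ℝ) : Set (ι → C → ℝ) :=
  {b | (∀ c, ∑ i, b i c = ∑ i, a i c) ∧ ∀ i, ∀ v : ℝ → ℝ, ConvexOn ℝ Set.univ v →
    ∑ c, d i c * p c * v (b i c) ≤ ∑ c, d i c * p c * v (a i c)}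

lemma isClosed_convexlyDominated (p : C → ℝ) (d a : ι → C → ℝ) :
    IsClosed (convexlyDominated p d a) := by
  simp only [convexlyDominated, Set.ofPred_and, Set.ofPred_forall]
  refine (isClosed_iInter fun c => isClosed_eq (by fun_prop) continuous_const).inter
    (isClosed_iInter fun i => isClosed_iInter fun v => isClosed_iInter fun hv =>
      isClosed_le ?_ continuous_const)
  have : Continuous v := continuousOn_univ.1 (hv.continuousOn isOpen_univ)
  fun_prop

lemma exists_isMinOn_convexlyDominated {p : C → ℝ} (hp : ∀ c, 0 < p c) (d a : ι → C → ℝ) :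
    ∃ b ∈ convexlyDominated p d a, ∀ b' ∈ convexlyDominated p d a,
      ∑ i, ∑ c, p c * b i c ^ 2 ≤ ∑ i, ∑ c, p c * b' i c ^ 2 := by
  set obj : (ι → C → ℝ) → ℝ := fun b => ∑ i, ∑ c, p c * b i c ^ 2 with hobj
  have hcont : Continuous obj := by fun_prop
  have ha : a ∈ convexlyDominated p d a := ⟨fun _ => rfl, fun _ _ _ => le_rfl⟩
  have hK : IsCompact (convexlyDominated p d a ∩ {b | obj b ≤ obj a}) := by
    refine IsCompact.of_isClosed_subset (isCompact_univ_pi fun _ : ι => isCompact_univ_pi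
      fun c : C => isCompact_Icc (a := -√(obj a / p c)) (b := √(obj a / p c)))
      ((isClosed_convexlyDominated p d a).inter (isClosed_le hcont continuous_const)) ?_
    rintro b ⟨-, hb⟩ i - c -
    rw [← abs_le'.trans and_comm |>.trans (and_congr_left' neg_le) |>.trans Set.mem_Icc.symm]
    apply Real.abs_le_sqrt
    rw [le_div_iff₀' (hp c)]
    refine le_trans ?_ hb
    have h0 : ∀ i c, 0 ≤ p c * b i c ^ 2 := fun i c => mul_nonneg (hp c).le (sq_nonneg _)
    exact (Finset.single_le_sum (f := fun c => p c * b i c ^ 2) (fun c _ => h0 i c)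
      (Finset.mem_univ c)).trans (Finset.single_le_sum (f := fun i => ∑ c, p c * b i c ^ 2)
        (fun i _ => Finset.sum_nonneg fun c _ => h0 i c) (Finset.mem_univ i))
  obtain ⟨b, hb, hmin⟩ := hK.exists_isMinOn ⟨a, ha, le_refl (obj a)⟩ hcont.continuousOn
  refine ⟨b, hb.1, fun b' hb' => ?_⟩
  rcases le_total (obj b') (obj a) with h | h
  · exact hmin ⟨hb', h⟩
  · exact hb.2.trans h

/-- A minimiser of the quadratic objective is monotone in the total endowment among states with the
same densities: otherwise one agent's payoff falls and another's rises between two such states, and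
a small transfer between these two agents contracts both of their positions. -/
lemma monotone_of_isMinOn_convexlyDominated {p : C → ℝ} (hp : ∀ c, 0 < p c) {d a b : ι → C → ℝ}
    (hd : ∀ i c, 0 ≤ d i c) (hb : b ∈ convexlyDominated p d a)
    (hmin : ∀ b' ∈ convexlyDominated p d a,
      ∑ i, ∑ c, p c * b i c ^ 2 ≤ ∑ i, ∑ c, p c * b' i c ^ 2)
    {c c' : C} (hdc : ∀ i, d i c = d i c') (hy : ∑ i, b i c ≤ ∑ i, b i c') (i : ι) :
    b i c ≤ b i c' := by
  classical
  by_contra! hi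
  obtain ⟨j, hj⟩ : ∃ j, b j c < b j c' := by
    by_contra! h
    exact absurd (Finset.sum_lt_sum (fun k _ => h k) ⟨i, Finset.mem_univ i, hi⟩) hy.not_gt
  have hij : i ≠ j := by rintro rfl; exact lt_asymm hi hj
  obtain ⟨ε, hε, hεi, hεi', hεj, hεj'⟩ : ∃ ε : ℝ, 0 < ε ∧ ε * (p c)⁻¹ < b i c - b i c' ∧
      ε * (p c')⁻¹ < b i c - b i c' ∧ ε * (p c)⁻¹ < b j c' - b j c ∧
      ε * (p c')⁻¹ < b j c' - b j c := by
    have key : ∀ m δ : ℝ, 0 < δ → ∀ᶠ ε in 𝓝[>] (0 : ℝ), ε * m < δ := fun m δ hδ => by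
      have : Tendsto (fun ε : ℝ => ε * m) (𝓝[>] 0) (𝓝 (0 * m)) :=
        (continuous_mul_const m).continuousWithinAt
      exact this.eventually_lt_const (by simpa using hδ)
    have hi0 := sub_pos.2 hi
    have hj0 := sub_pos.2 hj
    obtain ⟨ε, h⟩ := ((eventually_mem_nhdsWithin (a := (0 : ℝ)) (s := Set.Ioi 0)).and
      ((key _ _ hi0).and ((key _ _ hi0).and ((key _ _ hj0).and (key _ _ hj0))))).exists
    exact ⟨ε, h⟩
  set b' : ι → C → ℝ := fun k => if k = i then transfer p ε c c' (b i) else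
    if k = j then transfer p ε c' c (b j) else b k with hb'
  have hbi : b' i = transfer p ε c c' (b i) := by simp [hb']
  have hbj : b' j = transfer p ε c' c (b j) := by simp [hb', hij.symm]
  have hbk : ∀ k, k ≠ i → k ≠ j → b' k = b k := fun k h1 h2 => by simp [hb', h1, h2]
  have hmem : b' ∈ convexlyDominated p d a := by
    refine ⟨fun x => ?_, fun k v hv => ?_⟩
    · rw [← hb.1 x, ← sub_eq_zero, ← Finset.sum_sub_distrib, Finset.sum_eq_add i j hij]
      · rw [hbi, hbj]
        simp only [transfer]
        ring
      · rintro k - ⟨h1, h2⟩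
        rw [hbk k h1 h2, sub_self]
      · simp
      · simp
    · refine le_trans ?_ (hb.2 k v hv)
      by_cases h1 : k = i
      · subst h1
        rw [hbi]
        exact sum_convex_transfer_le hp hε.le hi hεi.le hεi'.le (hd _ _) (hdc _) hv
      · by_cases h2 : k = j
        · subst h2
          rw [hbj]
          exact sum_convex_transfer_le hp hε.le hj hεj'.le hεj.le (hd _ _) (hdc _).symm hv
        · rw [hbk k h1 h2]
  refine (hmin b' hmem).not_gt (Finset.sum_lt_sum (fun k _ => ?_) ⟨i, Finset.mem_univ i, ?_⟩)
  · by_cases h1 : k = i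
    · subst h1
      rw [hbi]
      exact (sum_sq_transfer_lt hp hε hi hεi.le hεi').le
    · by_cases h2 : k = j
      · subst h2
        rw [hbj]
        exact (sum_sq_transfer_lt hp hε hj hεj'.le hεj).le
      · rw [hbk k h1 h2]
  · rw [hbi]
    exact sum_sq_transfer_lt hp hε hi hεi.le hεi'

/-- Comonotone improvement on a finite state space: among states with the same densities, the
improved positions are nondecreasing in the aggregate and add up to it, hence are `1`-Lipschitz
functions of it; only the Lipschitz bound is recorded. -/
theorem exists_comonotone_improvement {p : C → ℝ} (hp : ∀ c, 0 < p c) {d : ι → C → ℝ}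
    (hd : ∀ i c, 0 ≤ d i c) (a : ι → C → ℝ) :
    ∃ b ∈ convexlyDominated p d a, ∀ c c' : C, (∀ i, d i c = d i c') → ∀ i,
      |b i c - b i c'| ≤ |∑ j, a j c - ∑ j, a j c'| := by
  obtain ⟨b, hb, hmin⟩ := exists_isMinOn_convexlyDominated hp d a
  have hmono : ∀ c c' : C, (∀ i, d i c = d i c') → ∑ j, b j c ≤ ∑ j, b j c' → ∀ i,
      |b i c - b i c'| ≤ |∑ j, b j c - ∑ j, b j c'| := by
    intro c c' hdc hy i
    have h := monotone_of_isMinOn_convexlyDominated hp hd hb hmin hdc hy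
    rw [abs_sub_comm, abs_sub_comm (∑ j, b j c), abs_of_nonneg (sub_nonneg.2 (h i)),
      abs_of_nonneg (sub_nonneg.2 hy), ← Finset.sum_sub_distrib]
    exact Finset.single_le_sum (f := fun j => b j c' - b j c)
      (fun j _ => sub_nonneg.2 (h j)) (Finset.mem_univ i)
  refine ⟨b, hb, fun c c' hdc i => ?_⟩
  rw [← hb.1 c, ← hb.1 c']
  rcases le_total (∑ j, b j c) (∑ j, b j c') with hy | hy
  · exact hmono c c' hdc hy i
  · rw [abs_sub_comm, abs_sub_comm (∑ j, b j c)]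
    exact hmono c' c (fun i => (hdc i).symm) hy i

end Finite

/-! ### Approximately comonotone improvement in `L^∞` -/

section Cells

variable {Ω : Type*} [MeasurableSpace Ω] {P : Measure Ω}

lemma ae_abs_le_norm (X : Linf P) : ∀ᵐ ω ∂P, |X ω| ≤ ‖X‖ := by
  have := ae_le_lpNorm_exponent_top (Lp.memLp X)
  rwa [← toReal_eLpNorm (Lp.memLp X).aestronglyMeasurable, ← Lp.norm_def] at this

lemma norm_le_of_ae_abs_le [IsFiniteMeasure P] {X : Linf P} {r : ℝ} (hr : 0 ≤ r)
    (h : ∀ᵐ ω ∂P, |X ω| ≤ r) : ‖X‖ ≤ r := by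
  simpa using Lp.norm_le_of_ae_bound (f := X) hr h

lemma abs_sub_mul_floor_le {η : ℝ} (hη : 0 < η) (x : ℝ) : |x - η * ⌊x / η⌋| ≤ η := by
  have h1 := Int.floor_le (x / η)
  have h2 := Int.lt_floor_add_one (x / η)
  rw [le_div_iff₀' hη] at h1
  rw [div_lt_iff₀' hη] at h2
  rw [abs_le]
  constructor <;> linarith

/-- A simple function is almost surely a function of one all of whose finitely many values are
attained with positive probability. -/
lemma exists_cells_of_simpleFunc {T : Type*} [NeZero P] (g : SimpleFunc Ω T) :
    ∃ (C : Finset T) (τ : SimpleFunc Ω C), (∀ c, P (τ ⁻¹' {c}) ≠ 0) ∧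
      ∀ᵐ ω ∂P, (τ ω : T) = g ω := by
  classical
  set C := g.range.filter fun t => P (g ⁻¹' {t}) ≠ 0 with hC
  have hmem : ∀ᵐ ω ∂P, g ω ∈ C := by
    have : ∀ᵐ ω ∂P, ∀ t ∈ g.range, P (g ⁻¹' {t}) = 0 → g ω ≠ t := by
      rw [Finset.eventually_all]
      intro t _
      by_cases ht : P (g ⁻¹' {t}) = 0
      · filter_upwards [measure_eq_zero_iff_ae_notMem.1 ht] with ω hω _ h using hω h
      · exact Eventually.of_forall fun ω h => absurd h ht
    filter_upwards [this] with ω hω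
    exact Finset.mem_filter.2 ⟨g.mem_range_self ω, fun h => hω _ (g.mem_range_self ω) h rfl⟩
  obtain ⟨ω₀, h₀⟩ := hmem.exists
  have hae : ∀ᵐ ω ∂P, (((g.map fun t => if h : t ∈ C then (⟨t, h⟩ : C) else ⟨g ω₀, h₀⟩) ω : C) : T)
      = g ω := by
    filter_upwards [hmem] with ω hω
    simp [hω]
  refine ⟨C, g.map fun t => if h : t ∈ C then ⟨t, h⟩ else ⟨g ω₀, h₀⟩, fun c hc => ?_, hae⟩
  refine (Finset.mem_filter.1 c.2).2 ?_
  rw [measure_eq_zero_iff_ae_notMem] at hc ⊢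
  filter_upwards [hc, hae] with ω h1 h2 h3
  exact h1 (Subtype.ext (h2.trans h3))

/-- A finite partition into cells of positive probability on which a given simple function is
constant and a given bounded random variable oscillates little. -/
lemma exists_cells {β : Type} [IsProbabilityMeasure P] (D : SimpleFunc Ω β) (Y : Linf P) {η : ℝ}
    (hη : 0 < η) :
    ∃ (C : Type) (_ : Fintype C) (τ : SimpleFunc Ω C) (δ : C → β) (y : C → ℝ),
      (∀ c, P (τ ⁻¹' {c}) ≠ 0) ∧ ∀ᵐ ω ∂P, D ω = δ (τ ω) ∧ |Y ω - y (τ ω)| ≤ η := by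
  have hm : Measurable fun ω => ⌊max (-‖Y‖) (min ‖Y‖ (Y ω)) / η⌋ :=
    ((measurable_const.max (measurable_const.min
      (Lp.stronglyMeasurable Y).measurable)).div_const η).floor
  let q : SimpleFunc Ω ℤ := ⟨fun ω => ⌊max (-‖Y‖) (min ‖Y‖ (Y ω)) / η⌋,
    fun x => hm (measurableSet_singleton x), by
      refine (Set.finite_Icc ⌊-‖Y‖ / η⌋ ⌊‖Y‖ / η⌋).subset ?_
      rintro _ ⟨ω, rfl⟩
      have h1 : max (-‖Y‖) (min ‖Y‖ (Y ω)) ≤ ‖Y‖ :=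
        max_le (by linarith [norm_nonneg Y]) (min_le_left _ _)
      exact ⟨Int.floor_le_floor (by gcongr; exact le_max_left _ _),
        Int.floor_le_floor (by gcongr)⟩⟩
  obtain ⟨C, τ, hτ, hae⟩ := exists_cells_of_simpleFunc (P := P) (D.pair q)
  refine ⟨C, inferInstance, τ, fun c => c.1.1, fun c => η * c.1.2, hτ, ?_⟩
  filter_upwards [hae, ae_abs_le_norm Y] with ω h1 h2
  have h3 : max (-‖Y‖) (min ‖Y‖ (Y ω)) = Y ω := by
    rw [min_eq_right (abs_le.1 h2).2, max_eq_right (abs_le.1 h2).1]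
  rw [h1]
  refine ⟨rfl, ?_⟩
  have : (D.pair q ω).2 = ⌊Y ω / η⌋ := by
    simp only [SimpleFunc.pair_apply, q, SimpleFunc.coe_mk, h3]
  rw [this]
  exact abs_sub_mul_floor_le hη _

lemma integral_eq_sum_cells {C : Type*} [Fintype C] (τ : SimpleFunc Ω C) {g : Ω → ℝ}
    (hg : Integrable g P) : ∫ ω, g ω ∂P = ∑ c, ∫ ω in τ ⁻¹' {c}, g ω ∂P := by
  rw [← integral_iUnion_fintype (fun c => τ.measurableSet_fiber c) ?_
    (fun c => hg.integrableOn), ← Set.preimage_iUnion]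
  · rw [Set.iUnion_of_singleton, Set.preimage_univ, setIntegral_univ]
  · exact fun c c' h => (Set.disjoint_singleton.2 h).preimage τ

lemma integrable_comp_of_monotone [IsFiniteMeasure P] (X : Linf P) {v : ℝ → ℝ} (hv : Monotone v) :
    Integrable (fun ω => v (X ω)) P := by
  refine Integrable.of_bound (C := max |v (-‖X‖)| |v ‖X‖|)
    (hv.measurable.comp (Lp.stronglyMeasurable X).measurable).aestronglyMeasurable ?_
  filter_upwards [ae_abs_le_norm X] with ω hω
  rw [abs_le] at hω
  exact abs_le_max_abs_abs (hv hω.1) (hv hω.2)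

lemma integrable_linf [IsFiniteMeasure P] (X : Linf P) : Integrable X P :=
  integrable_comp_of_monotone X (v := id) monotone_id

/-- If the density of `Q` is constant on cells, `Q`-expectations are weighted sums of cell
integrals with respect to `P`. -/
lemma integral_eq_sum_density_cells [IsFiniteMeasure P] {Q : Measure Ω} [IsFiniteMeasure Q]
    (hQP : Q ≪ P) {C : Type*} [Fintype C] (τ : SimpleFunc Ω C) {d : C → ℝ}
    (hd : (fun ω => (Q.rnDeriv P ω).toReal) =ᵐ[P] fun ω => d (τ ω)) {g : Ω → ℝ}
    (hg : Integrable g P) : ∫ ω, g ω ∂Q = ∑ c, d c * ∫ ω in τ ⁻¹' {c}, g ω ∂P := by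
  have h1 : ∫ ω, g ω ∂Q = ∫ ω, (τ.map d) ω * g ω ∂P := by
    rw [← integral_rnDeriv_smul hQP]
    refine integral_congr_ae ?_
    filter_upwards [hd] with ω hω
    simp [hω]
  obtain ⟨r, hr⟩ := (τ.map d).exists_forall_norm_le
  rw [h1, integral_eq_sum_cells τ (hg.bdd_mul (τ.map d).aestronglyMeasurable
    (Eventually.of_forall hr))]
  refine Finset.sum_congr rfl fun c _ => ?_
  rw [← integral_const_mul]
  refine setIntegral_congr_fun (τ.measurableSet_fiber c) fun ω hω => ?_
  have : τ ω = c := hω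
  simp [this]

lemma density_nonneg_of_cells {Q : Measure Ω} {C : Type*} {τ : Ω → C} {d : C → ℝ}
    (hτ : ∀ c, P (τ ⁻¹' {c}) ≠ 0)
    (hd : (fun ω => (Q.rnDeriv P ω).toReal) =ᵐ[P] fun ω => d (τ ω)) (c : C) : 0 ≤ d c := by
  obtain ⟨ω, h1, h2⟩ := ((frequently_ae_mem_iff.2 (hτ c)).and_eventually hd).exists
  have : τ ω = c := h1
  rw [← this]
  exact ENNReal.toReal_nonneg.trans_eq h2

/-- Passing to cell averages and then to a smaller position in the convex order of the cell
weights decreases a position in the sense of second-order stochastic dominance. -/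
lemma ssDominates_of_cells [IsProbabilityMeasure P] {Q : Measure Ω} [IsFiniteMeasure Q]
    (hQP : Q ≪ P) {C : Type*} [Fintype C] (τ : SimpleFunc Ω C) (hτ : ∀ c, P (τ ⁻¹' {c}) ≠ 0)
    {d : C → ℝ} (hd : (fun ω => (Q.rnDeriv P ω).toReal) =ᵐ[P] fun ω => d (τ ω))
    (A B : Linf P) {b : C → ℝ} (hB : ∀ᵐ ω ∂P, B ω = b (τ ω))
    (hb : ∀ v : ℝ → ℝ, ConvexOn ℝ Set.univ v → ∑ c, d c * P.real (τ ⁻¹' {c}) * v (b c) ≤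
      ∑ c, d c * P.real (τ ⁻¹' {c}) * v (⨍ ω in τ ⁻¹' {c}, A ω ∂P)) :
    SSDominates Q A B := by
  intro v hv hmono
  rw [integral_eq_sum_density_cells hQP τ hd (integrable_comp_of_monotone A hmono),
    integral_eq_sum_density_cells hQP τ hd (integrable_comp_of_monotone B hmono)]
  refine le_trans (le_of_eq ?_) ((hb v hv).trans (Finset.sum_le_sum fun c _ => ?_))
  · refine Finset.sum_congr rfl fun c _ => ?_
    have : ∀ᵐ ω ∂P, ω ∈ τ ⁻¹' {c} → v (B ω) = v (b c) := by
      filter_upwards [hB] with ω h1 h2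
      rw [h1, show τ ω = c from h2]
    rw [setIntegral_congr_ae (τ.measurableSet_fiber c) this, setIntegral_const, smul_eq_mul,
      mul_assoc]
  · rw [mul_assoc]
    refine mul_le_mul_of_nonneg_left ?_ (density_nonneg_of_cells hτ hd c)
    have hvc : Continuous v := continuousOn_univ.1 (hv.continuousOn isOpen_univ)
    have := hv.map_set_average_le hvc.continuousOn isClosed_univ (hτ c) (measure_ne_top _ _)
      (by simp) (integrable_linf A).integrableOn
      (integrable_comp_of_monotone A hmono).integrableOn
    have hpos : 0 < P.real (τ ⁻¹' {c}) :=
      ENNReal.toReal_pos (hτ c) (measure_ne_top _ _)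
    rwa [setAverage_eq _ (fun ω => v (A ω)), smul_eq_mul, ← div_eq_inv_mul,
      le_div_iff₀' hpos] at this

/-- Up to an error `δ`, the position `V` oscillates almost surely at most as much as `W` within each
level set of `D`. -/
def OscControlled {β : Type*} (D : Ω → β) (V W : Linf P) (δ : ℝ) : Prop :=
  ∃ G ∈ ae P, ∀ ω ∈ G, ∀ ω' ∈ G, D ω = D ω' → |V ω - V ω'| ≤ |W ω - W ω'| + δ

lemma OscControlled.smul {β : Type*} {D : Ω → β} {V W : Linf P} {δ : ℝ}
    (h : OscControlled D V W δ) {s : ℝ} (hs : 0 ≤ s) (hs1 : s ≤ 1) (hδ : 0 ≤ δ) :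
    OscControlled D (s • V) (s • W) δ := by
  obtain ⟨G, hG, h⟩ := h
  refine ⟨_, inter_mem hG (inter_mem (Lp.coeFn_smul s V) (Lp.coeFn_smul s W)), ?_⟩
  rintro ω ⟨h1, h2, h3⟩ ω' ⟨h1', h2', h3'⟩ hD
  have e1 : (s • V) ω = s * V ω := h2
  have e2 : (s • V) ω' = s * V ω' := h2'
  have e3 : (s • W) ω = s * W ω := h3
  have e4 : (s • W) ω' = s * W ω' := h3'
  rw [e1, e2, e3, e4, ← mul_sub, ← mul_sub, abs_mul, abs_mul, abs_of_nonneg hs]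
  have := mul_le_mul_of_nonneg_left (h ω h1 ω' h1' hD) hs
  nlinarith

/-- Approximate comonotone improvement: up to an arbitrarily small error, every allocation can be
replaced by one that each agent prefers and in which, wherever all densities agree, no position
oscillates more than the aggregate. -/
theorem exists_improved_allocation [IsProbabilityMeasure P] {ι : Type} [Fintype ι]
    {Q : ι → Measure Ω} [∀ i, IsProbabilityMeasure (Q i)] (hQP : ∀ i, Q i ≪ P)
    {D : SimpleFunc Ω (ι → ℝ)}
    (hD : ∀ i, (fun ω => ((Q i).rnDeriv P ω).toReal) =ᵐ[P] fun ω => D ω i)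
    (A : ι → Linf P) {ε : ℝ} (hε : 0 < ε) :
    ∃ B : ι → Linf P, (∀ i, SSDominates (Q i) (A i) (B i)) ∧ ‖∑ i, A i - ∑ i, B i‖ ≤ ε ∧
      ∀ i, OscControlled D (B i) (∑ j, A j) ε := by
  obtain ⟨C, _, τ, δ, y, hτ, hae⟩ := exists_cells D (∑ i, A i) (η := ε / 4) (by positivity)
  have hd : ∀ i, (fun ω => ((Q i).rnDeriv P ω).toReal) =ᵐ[P] fun ω => δ (τ ω) i := fun i => by
    filter_upwards [hD i, hae] with ω h1 h2
    rw [h1, h2.1]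
  have hp : ∀ c, 0 < P.real (τ ⁻¹' {c}) := fun c =>
    ENNReal.toReal_pos (hτ c) (measure_ne_top _ _)
  set a : ι → C → ℝ := fun i c => ⨍ ω in τ ⁻¹' {c}, A i ω ∂P with ha
  -- the aggregate of the cell averages is close to the aggregate endowment
  have hsum : ∀ c, ∑ i, a i c = ⨍ ω in τ ⁻¹' {c}, (∑ i, A i : Linf P) ω ∂P := fun c => by
    simp only [ha, setAverage_eq]
    rw [← Finset.smul_sum, ← integral_finsetSum _ fun i _ => (integrable_linf (A i)).integrableOn]
    congr 1
    refine setIntegral_congr_ae (τ.measurableSet_fiber c) ?_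
    filter_upwards [Lp.coeFn_finsetSum Finset.univ A] with ω h _
    rw [h, Finset.sum_apply]
  have hclose : ∀ c, |∑ i, a i c - y c| ≤ ε / 4 := fun c => by
    rw [hsum c, ← Real.dist_eq, ← Metric.mem_closedBall]
    refine (convex_closedBall (y c) (ε / 4)).set_average_mem Metric.isClosed_closedBall (hτ c)
      (measure_ne_top _ _) ?_ (integrable_linf _).integrableOn
    refine (ae_restrict_iff' (τ.measurableSet_fiber c)).2 ?_
    filter_upwards [hae] with ω h1 h2
    rw [Metric.mem_closedBall, Real.dist_eq, ← show τ ω = c from h2]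
    exact h1.2
  have hagg : ∀ᵐ ω ∂P, |(∑ i, A i : Linf P) ω - ∑ i, a i (τ ω)| ≤ ε / 2 := by
    filter_upwards [hae] with ω hω
    have h1 := abs_le.1 hω.2
    have h2 := abs_le.1 (hclose (τ ω))
    exact abs_le.2 ⟨by linarith, by linarith⟩
  obtain ⟨b, ⟨hbs, hbc⟩, hosc⟩ := exists_comonotone_improvement hp (d := fun i c => δ c i)
    (fun i c => density_nonneg_of_cells (d := fun c => δ c i) hτ (hd i) c) a
  set B : ι → Linf P := fun i => ((τ.map (b i)).memLp_top P).toLp _ with hBdef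
  have hB : ∀ᵐ ω ∂P, ∀ i, B i ω = b i (τ ω) := ae_all_iff.2 fun i =>
    ((τ.map (b i)).memLp_top P).coeFn_toLp
  refine ⟨B, fun i => ssDominates_of_cells (hQP i) τ hτ (hd i) (A i) (B i)
    (hB.mono fun ω h => h i) (hbc i), ?_, fun i => ?_⟩
  · refine norm_le_of_ae_abs_le hε.le ?_
    filter_upwards [hB, hagg, Lp.coeFn_sub (∑ i, A i) (∑ i, B i),
      Lp.coeFn_finsetSum Finset.univ B] with ω h1 h2 h3 h4
    rw [h3, Pi.sub_apply, h4, Finset.sum_apply, Finset.sum_congr rfl fun i _ => h1 i, hbs]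
    linarith
  · refine ⟨_, inter_mem hB (inter_mem hagg hae), ?_⟩
    rintro ω ⟨h1, h2, h3⟩ ω' ⟨h1', h2', h3'⟩ hDD
    have e1 : B i ω = b i (τ ω) := h1 i
    have e2 : B i ω' = b i (τ ω') := h1' i
    have e3 : |(∑ i, A i : Linf P) ω - ∑ i, a i (τ ω)| ≤ ε / 2 := h2
    have e4 : |(∑ i, A i : Linf P) ω' - ∑ i, a i (τ ω')| ≤ ε / 2 := h2'
    have e5 : D ω = δ (τ ω) := h3.1
    have e6 : D ω' = δ (τ ω') := h3'.1
    rw [e1, e2]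
    refine (hosc (τ ω) (τ ω') (fun j => by rw [← e5, ← e6, hDD]) i).trans ?_
    rw [abs_sub_comm] at e3
    have := abs_sub_le (∑ j, a j (τ ω)) ((∑ i, A i : Linf P) ω) (∑ j, a j (τ ω'))
    have := abs_sub_le ((∑ i, A i : Linf P) ω) ((∑ i, A i : Linf P) ω') (∑ j, a j (τ ω'))
    linarith

end Cells

/-! ### Total boundedness under control of oscillations -/

section Compactness

lemma totallyBounded_range_of_discretization {E : Type*} [PseudoMetricSpace E] {V : ℕ → E}
    (H : ∀ ε > (0 : ℝ), ∃ (γ : Type) (F : ℕ → γ), (Set.range F).Finite ∧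
      ∀ k l, F k = F l → dist (V k) (V l) < ε) : TotallyBounded (Set.range V) := by
  refine Metric.totallyBounded_iff.2 fun ε hε => ?_
  obtain ⟨γ, F, hfin, hF⟩ := H ε hε
  have : Finite (Set.range F) := hfin
  refine ⟨Set.range fun t : Set.range F => V t.2.choose, Set.finite_range _, ?_⟩
  rintro _ ⟨k, rfl⟩
  simp only [Set.mem_iUnion]
  refine ⟨_, ⟨⟨F k, k, rfl⟩, rfl⟩, hF _ _ ?_⟩
  exact (Exists.choose_spec (⟨k, rfl⟩ : ∃ l, F l = F k)).symm

variable {Ω : Type*} [MeasurableSpace Ω] {P : Measure Ω}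

/-- A compactness criterion of Arzelà–Ascoli type: a bounded sequence of positions whose
oscillations are asymptotically controlled by those of a convergent sequence is totally bounded in
`L^∞`. Up to a small error, all but finitely many members of the sequence are determined by their
values at finitely many sample points, one for each cell on which `D` is constant and the limit
`W₀` almost so. -/
theorem totallyBounded_of_oscControlled [IsProbabilityMeasure P] {β : Type} (D : SimpleFunc Ω β)
    {V W : ℕ → Linf P} {W₀ : Linf P} {R : ℝ} (hV : ∀ k, ‖V k‖ ≤ R)
    (hW : Tendsto W atTop (𝓝 W₀)) {δ : ℕ → ℝ} (hδ : Tendsto δ atTop (𝓝 0))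
    (hosc : ∀ k, OscControlled D (V k) (W k) (δ k)) : TotallyBounded (Set.range V) := by
  refine totallyBounded_range_of_discretization fun ε hε => ?_
  obtain ⟨η, hη, hηε⟩ : ∃ η : ℝ, 0 < η ∧ 9 * η < ε := ⟨ε / 10, by positivity, by linarith⟩
  obtain ⟨K, hK⟩ : ∃ K, ∀ k ≥ K, ‖W k - W₀‖ ≤ η ∧ δ k ≤ η := by
    have h1 : ∀ᶠ k in atTop, ‖W k - W₀‖ ≤ η :=
      (tendsto_iff_norm_sub_tendsto_zero.1 hW).eventually_le_const hη
    exact eventually_atTop.1 (h1.and (hδ.eventually_le_const hη))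
  choose G hG hosc using hosc
  -- a set of full measure on which all the almost sure relations hold everywhere
  have hfull : ∀ᵐ ω ∂P, (∀ k, ω ∈ G k ∧ |V k ω| ≤ R ∧ |W k ω - W₀ ω| ≤ ‖W k - W₀‖) ∧
      |W₀ ω| ≤ ‖W₀‖ := by
    refine (ae_all_iff.2 fun k => ?_).and (ae_abs_le_norm W₀)
    filter_upwards [hG k, ae_abs_le_norm (V k), ae_abs_le_norm (W k - W₀),
      Lp.coeFn_sub (W k) W₀] with ω h1 h2 h3 h4
    refine ⟨h1, h2.trans (hV k), ?_⟩
    rwa [h4] at h3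
  set H : Set Ω := {ω | (∀ k, ω ∈ G k ∧ |V k ω| ≤ R ∧ |W k ω - W₀ ω| ≤ ‖W k - W₀‖) ∧
      |W₀ ω| ≤ ‖W₀‖} with hH
  set κ : Ω → β × ℤ := fun ω => (D ω, ⌊W₀ ω / η⌋) with hκ
  have hTfin : (κ '' H).Finite := by
    refine (D.finite_range.prod (Set.finite_Icc ⌊-‖W₀‖ / η⌋ ⌊‖W₀‖ / η⌋)).subset ?_
    rintro _ ⟨ω, hω, rfl⟩
    have h := abs_le.1 hω.2
    exact ⟨⟨ω, rfl⟩, Int.floor_le_floor (by gcongr; exact h.1),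
      Int.floor_le_floor (by gcongr; exact h.2)⟩
  have : Finite (κ '' H) := hTfin
  choose rep hrepH hrep using fun t : κ '' H => t.2
  -- all but finitely many members oscillate at most `4 η` on each cell
  have hcell : ∀ k ≥ K, ∀ ω (hω : ω ∈ H),
      |V k ω - V k (rep ⟨κ ω, ω, hω, rfl⟩)| ≤ 4 * η := by
    intro k hk ω hω
    set ω' := rep ⟨κ ω, ω, hω, rfl⟩ with hω'
    have hr : ω' ∈ H := hrepH _
    have hκ' : κ ω' = κ ω := hrep _
    have hD : D ω = D ω' := (congrArg Prod.fst hκ').symm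
    have hfl : ⌊W₀ ω' / η⌋ = ⌊W₀ ω / η⌋ := congrArg Prod.snd hκ'
    have h0 : |W₀ ω - W₀ ω'| ≤ η := by
      have := Int.abs_sub_lt_one_of_floor_eq_floor hfl.symm
      rw [← sub_div, abs_div, abs_of_pos hη, div_lt_one hη] at this
      exact this.le
    have h1 := hosc k ω (hω.1 k).1 ω' (hr.1 k).1 hD
    have h2 := abs_le.1 ((hω.1 k).2.2.trans (hK k hk).1)
    have h3 := abs_le.1 ((hr.1 k).2.2.trans (hK k hk).1)
    have h4 : |W k ω - W k ω'| ≤ 3 * η := by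
      rw [abs_le] at h0 ⊢
      constructor <;> linarith
    linarith [(hK k hk).2]
  refine ⟨ℕ ⊕ (κ '' H → ℤ), fun k => if k < K then Sum.inl k else
    Sum.inr fun t => ⌊V k (rep t) / η⌋, ?_, fun k l hkl => ?_⟩
  · refine (((Set.finite_Iio K).image Sum.inl).union ((Set.Finite.pi' fun _ : κ '' H =>
      Set.finite_Icc ⌊-R / η⌋ ⌊R / η⌋).image Sum.inr)).subset ?_
    rintro _ ⟨k, rfl⟩
    by_cases hk : k < K
    · exact Or.inl ⟨k, hk, by simp [hk]⟩
    · refine Or.inr ⟨fun t => ⌊V k (rep t) / η⌋, fun t => ?_, by simp [hk]⟩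
      have h := abs_le.1 ((hrepH t).1 k).2.1
      exact ⟨Int.floor_le_floor (by gcongr; exact h.1), Int.floor_le_floor (by gcongr; exact h.2)⟩
  · by_cases hk : k < K <;> by_cases hl : l < K <;> simp only [hk, hl, if_true, if_false,
      reduceCtorEq, Sum.inl.injEq, Sum.inr.injEq] at hkl
    · rw [hkl, dist_self]
      exact hε
    · rw [dist_eq_norm]
      refine (norm_le_of_ae_abs_le (r := 9 * η) (by positivity) ?_).trans_lt hηε
      filter_upwards [hfull, Lp.coeFn_sub (V k) (V l)] with ω hω hsub
      rw [hsub, Pi.sub_apply]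
      have h1 := abs_le.1 (hcell k (not_lt.1 hk) ω hω)
      have h2 := abs_le.1 (hcell l (not_lt.1 hl) ω hω)
      have h3 := Int.abs_sub_lt_one_of_floor_eq_floor (congrFun hkl ⟨κ ω, ω, hω, rfl⟩)
      rw [← sub_div, abs_div, abs_of_pos hη, div_lt_one hη, abs_lt] at h3
      rw [abs_le]
      constructor <;> linarith

end Compactness

/-! ### Attainment of the minimal price -/

section Sharing

variable {Ω : Type*} [MeasurableSpace Ω] {P : Measure Ω}

lemma IsMonetaryRiskMeasure.le_add_norm_sub [IsProbabilityMeasure P] {ρ : Linf P → ℝ}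
    (hρ : IsMonetaryRiskMeasure ρ)
    (X Y : Linf P) : ρ X ≤ ρ Y + ‖X - Y‖ := by
  rw [← hρ.cash_additive]
  refine hρ.monotone _ _ ((Lp.coeFn_le _ _).1 ?_)
  filter_upwards [ae_abs_le_norm (X - Y), Lp.coeFn_sub X Y,
    Lp.coeFn_add Y (Lp.const ∞ P ‖X - Y‖), Lp.coeFn_const (p := ∞) (μ := P) ‖X - Y‖]
    with ω h1 h2 h3 h4
  rw [h2, Pi.sub_apply] at h1
  rw [h3, Pi.add_apply, h4, Function.const_apply]
  linarith [(abs_le.1 h1).2]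

lemma IsMonetaryRiskMeasure.isClosed_acceptanceSet [IsProbabilityMeasure P] {ρ : Linf P → ℝ}
    (hρ : IsMonetaryRiskMeasure ρ) : IsClosed (acceptanceSet ρ) := by
  refine isClosed_of_closure_subset fun X hX => ?_
  refine le_of_forall_pos_le_add (b := (0 : ℝ)) fun ε hε => ?_
  obtain ⟨Y, hY, hXY⟩ := Metric.mem_closure_iff.1 hX ε hε
  rw [dist_eq_norm] at hXY
  have h0 : ρ Y ≤ 0 := hY
  linarith [hρ.le_add_norm_sub X Y]

lemma exists_bound_of_conjugate_lt_top {ρ : Linf P → ℝ} {φ : Linf P →L[ℝ] ℝ}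
    (h : conjugate ρ φ < ⊤) : ∃ C : ℝ, ∀ Y ∈ acceptanceSet ρ, φ Y ≤ C := by
  obtain ⟨C, hC, -⟩ := EReal.lt_iff_exists_real_btwn.1 h
  have hle : ∀ Y, φ Y - ρ Y ≤ C := fun Y =>
    EReal.coe_le_coe_iff.1 ((le_iSup (fun X : Linf P => ((φ X - ρ X : ℝ) : EReal)) Y).trans hC.le)
  refine ⟨C, fun Y hY => ?_⟩
  have h0 : ρ Y ≤ 0 := hY
  linarith [hle Y]

lemma map_asymptoticCone_nonpos {A : Set (Linf P)} {φ : Linf P →L[ℝ] ℝ} {C : ℝ}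
    (hC : ∀ Y ∈ A, φ Y ≤ C) {U : Linf P} (hU : U ∈ asymptoticCone A) : φ U ≤ 0 := by
  obtain ⟨s, Y, hs, hY, hs0, hlim⟩ := hU
  have h1 : Tendsto (fun k => s k * C) atTop (𝓝 (0 * C)) := hs0.mul_const C
  rw [zero_mul] at h1
  refine le_of_tendsto_of_tendsto' ((φ.continuous.tendsto U).comp hlim) h1 fun k => ?_
  simp only [Function.comp_apply, map_smul, smul_eq_mul]
  exact mul_le_mul_of_nonneg_left (hC _ (hY k)) (hs k).le

/-- Attainment of the minimal price of a security that makes the aggregate loss shareable among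
acceptable positions. A minimising sequence is replaced by approximately comonotone ones and then
rescaled by `s k = (1 + ∑ ‖B k i‖)⁻¹`, after which it has a convergent subsequence. If the scales
tend to zero, the limits lie in the asymptotic cones, so that compatibility forces them to
vanish although their norms sum up to one; otherwise, scaling back yields the minimiser. -/
theorem exists_acceptable_decomposition [IsProbabilityMeasure P] {ι : Type} [Fintype ι]
    {Q : ι → Measure Ω} [∀ i, IsProbabilityMeasure (Q i)] (hQP : ∀ i, Q i ≪ P)
    {D : SimpleFunc Ω (ι → ℝ)}
    (hD : ∀ i, (fun ω => ((Q i).rnDeriv P ω).toReal) =ᵐ[P] fun ω => D ω i)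
    {ρ : ι → Linf P → ℝ} (hρ : ∀ i, IsConsistentRiskMeasure (Q i) (ρ i))
    (M : Submodule ℝ (Linf P)) [FiniteDimensional ℝ M] (φ : Linf P →L[ℝ] ℝ)
    (hbdd : ∀ i, ∃ C : ℝ, ∀ Y ∈ acceptanceSet (ρ i), φ Y ≤ C)
    (hcone : ∀ i, ∀ U ∈ asymptoticCone (acceptanceSet (ρ i)), φ U = 0 → U = 0)
    (X : Linf P) (m : ℝ)
    (hm : ∀ ε > 0, ∃ A : ι → Linf P, (∀ i, A i ∈ acceptanceSet (ρ i)) ∧ ∃ Z : M,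
      ∑ i, A i + (Z : Linf P) = X ∧ φ Z ≤ m + ε) :
    ∃ A : ι → Linf P, (∀ i, A i ∈ acceptanceSet (ρ i)) ∧ ∃ Z : M,
      ∑ i, A i + (Z : Linf P) = X ∧ φ Z ≤ m := by
  have : ProperSpace M := FiniteDimensional.proper ℝ M
  have hε : ∀ k : ℕ, (0 : ℝ) < 1 / (k + 1) := fun k => Nat.one_div_pos_of_nat
  have hε1 : ∀ k : ℕ, (1 : ℝ) / (k + 1) ≤ 1 := fun k => by
    rw [div_le_one (by positivity)]
    linarith [Nat.cast_nonneg (α := ℝ) k]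
  have hε0 : Tendsto (fun k : ℕ => (1 : ℝ) / (k + 1)) atTop (𝓝 0) :=
    tendsto_one_div_add_atTop_nhds_zero_nat
  choose A hA Z hX hZ using fun k : ℕ => hm _ (hε k)
  choose B hB herr hosc using fun k : ℕ => exists_improved_allocation hQP hD (A k) (hε k)
  have hBacc : ∀ k i, B k i ∈ acceptanceSet (ρ i) := fun k i =>
    ((hρ i).consistent _ _ (hB k i)).trans (hA k i)
  have hsumA : ∀ k, ∑ i, A k i = X - (Z k : Linf P) := fun k => eq_sub_of_add_eq (hX k)
  simp only [hsumA] at herr hosc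
  set s : ℕ → ℝ := fun k => (1 + ∑ i, ‖B k i‖)⁻¹ with hs
  have ht : ∀ k, 0 ≤ ∑ i, ‖B k i‖ := fun k => Finset.sum_nonneg fun i _ => norm_nonneg _
  have hspos : ∀ k, 0 < s k := fun k => inv_pos.2 (by linarith [ht k])
  have hs1 : ∀ k, s k ≤ 1 := fun k => inv_le_one_of_one_le₀ (by linarith [ht k])
  have hnorm : ∀ k, s k + ∑ i, ‖s k • B k i‖ = 1 := fun k => by
    simp only [norm_smul, Real.norm_of_nonneg (hspos k).le]
    rw [← Finset.mul_sum]
    have : 1 + ∑ i, ‖B k i‖ ≠ 0 := by linarith [ht k]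
    simp only [hs]
    field_simp
  have hVle : ∀ k i, ‖s k • B k i‖ ≤ 1 := fun k i => by
    have := Finset.single_le_sum (f := fun i => ‖s k • B k i‖) (fun i _ => norm_nonneg _)
      (Finset.mem_univ i)
    linarith [hnorm k, hspos k]
  -- the scaled securities are bounded, hence have a convergent subsequence
  have herr' : ∀ k, ‖s k • (X - (Z k : Linf P) - ∑ i, B k i)‖ ≤ 1 / (k + 1) := fun k => by
    rw [norm_smul, Real.norm_of_nonneg (hspos k).le]
    exact (mul_le_of_le_one_left (norm_nonneg _) (hs1 k)).trans (herr k)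
  have hzle : ∀ k, ‖s k • Z k‖ ≤ ‖X‖ + 2 := fun k => by
    have e : ((s k • Z k : M) : Linf P) = s k • X - ∑ i, s k • B k i
        - s k • (X - (Z k : Linf P) - ∑ i, B k i) := by
      rw [← Finset.smul_sum, Submodule.coe_smul]
      module
    refine (congrArg norm e).trans_le ((norm_sub_le _ _).trans ?_)
    have h1 := norm_sub_le (s k • X) (∑ i, s k • B k i)
    have h2 := norm_sum_le Finset.univ fun i => s k • B k i
    have h3 : ‖s k • X‖ ≤ ‖X‖ := by
      rw [norm_smul, Real.norm_of_nonneg (hspos k).le]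
      exact mul_le_of_le_one_left (norm_nonneg _) (hs1 k)
    linarith [herr' k, hε1 k, hnorm k, hspos k]
  obtain ⟨⟨s₀, z₀⟩, -, φ₁, hφ₁, hlim₁⟩ := tendsto_subseq_of_bounded
    ((Metric.isBounded_Icc (0 : ℝ) 1).prod (Metric.isBounded_closedBall (x := (0 : M))
      (r := ‖X‖ + 2))) (x := fun k => (s k, s k • Z k)) fun k =>
      ⟨⟨(hspos k).le, hs1 k⟩, mem_closedBall_zero_iff.2 (hzle k)⟩
  have hs₁ : Tendsto (fun k => s (φ₁ k)) atTop (𝓝 s₀) := (Prod.tendsto_iff _ _).1 hlim₁ |>.1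
  have hz₁ : Tendsto (fun k => s (φ₁ k) • Z (φ₁ k)) atTop (𝓝 z₀) :=
    (Prod.tendsto_iff _ _).1 hlim₁ |>.2
  have hz₁' : Tendsto (fun k => s (φ₁ k) • (Z (φ₁ k) : Linf P)) atTop (𝓝 (z₀ : Linf P)) :=
    (continuous_subtype_val.tendsto z₀).comp hz₁
  -- along it, the scaled positions are totally bounded
  have htb : ∀ i, TotallyBounded (Set.range fun k => s (φ₁ k) • B (φ₁ k) i) := fun i => by
    refine totallyBounded_of_oscControlled D (fun k => hVle (φ₁ k) i)
      (W := fun k => s (φ₁ k) • (X - (Z (φ₁ k) : Linf P))) (W₀ := s₀ • X - z₀) ?_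
      (hε0.comp hφ₁.tendsto_atTop)
      fun k => (hosc (φ₁ k) i).smul (hspos _).le (hs1 _) (hε _).le
    simp only [smul_sub]
    exact (hs₁.smul_const X).sub hz₁'
  obtain ⟨V, -, φ₂, hφ₂, hlim₂⟩ := (isCompact_univ_pi fun i =>
    isCompact_iff_totallyBounded_isComplete.2 ⟨(htb i).closure, isClosed_closure.isComplete⟩
    ).tendsto_subseq
    (x := fun k i => s (φ₁ k) • B (φ₁ k) i) fun k i _ => subset_closure (Set.mem_range_self k)
  set ψ : ℕ → ℕ := φ₁ ∘ φ₂ with hψ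
  have hψ' : Tendsto ψ atTop atTop := hφ₁.tendsto_atTop.comp hφ₂.tendsto_atTop
  have hV : ∀ i, Tendsto (fun k => s (ψ k) • B (ψ k) i) atTop (𝓝 (V i)) :=
    fun i => tendsto_pi_nhds.1 hlim₂ i
  have hs₂ : Tendsto (fun k => s (ψ k)) atTop (𝓝 s₀) := hs₁.comp hφ₂.tendsto_atTop
  have hz₂ : Tendsto (fun k => s (ψ k) • (Z (ψ k) : Linf P)) atTop (𝓝 (z₀ : Linf P)) :=
    hz₁'.comp hφ₂.tendsto_atTop
  have hs₀ : 0 ≤ s₀ := ge_of_tendsto' hs₂ fun k => (hspos _).le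
  have hnorm₀ : s₀ + ∑ i, ‖V i‖ = 1 :=
    tendsto_nhds_unique (hs₂.add (tendsto_finsetSum _ fun i _ => (hV i).norm))
      (tendsto_const_nhds.congr fun k => (hnorm (ψ k)).symm)
  have hsum₀ : ∑ i, V i + (z₀ : Linf P) = s₀ • X := by
    have h1 : Tendsto (fun k => s (ψ k) • (X - (Z (ψ k) : Linf P) - ∑ i, B (ψ k) i)) atTop
        (𝓝 0) := squeeze_zero_norm (fun k => herr' (ψ k)) (hε0.comp hψ')
    have h2 : Tendsto (fun k => s (ψ k) • (X - (Z (ψ k) : Linf P) - ∑ i, B (ψ k) i)) atTop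
        (𝓝 (s₀ • X - z₀ - ∑ i, V i)) := by
      simp only [smul_sub, Finset.smul_sum]
      exact ((hs₂.smul_const X).sub hz₂).sub (tendsto_finsetSum _ fun i _ => hV i)
    have h3 := tendsto_nhds_unique h1 h2
    rw [sub_sub, eq_comm, sub_eq_zero] at h3
    rw [h3, add_comm]
  have hprice₀ : φ z₀ ≤ s₀ * m := by
    have h1 : Tendsto (fun k => s (ψ k) * (m + 1 / ((ψ k : ℕ) + 1 : ℝ))) atTop
        (𝓝 (s₀ * (m + 0))) := hs₂.mul ((hε0.comp hψ').const_add m)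
    rw [add_zero] at h1
    refine le_of_tendsto_of_tendsto' ((φ.continuous.tendsto _).comp hz₂) h1 fun k => ?_
    simp only [Function.comp_apply, map_smul, smul_eq_mul]
    exact mul_le_mul_of_nonneg_left (hZ (ψ k)) (hspos _).le
  rcases hs₀.eq_or_lt with h0 | h0
  · exfalso
    have hVcone : ∀ i, V i ∈ asymptoticCone (acceptanceSet (ρ i)) := fun i =>
      ⟨fun k => s (ψ k), fun k => B (ψ k) i, fun k => hspos _, fun k => hBacc _ _,
        by rwa [← h0] at hs₂, hV i⟩
    have hVle0 : ∀ i, φ (V i) ≤ 0 := fun i => by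
      obtain ⟨C, hC⟩ := hbdd i
      exact map_asymptoticCone_nonpos hC (hVcone i)
    have hVsum : 0 ≤ ∑ i, φ (V i) := by
      have := congrArg φ hsum₀
      rw [map_add, map_sum, ← h0, zero_smul, map_zero] at this
      rw [← h0, zero_mul] at hprice₀
      linarith
    have hVzero : ∀ i, V i = 0 := fun i => hcone i _ (hVcone i)
      ((Finset.sum_eq_zero_iff_of_nonpos fun i _ => hVle0 i).1
        (le_antisymm (Finset.sum_nonpos fun i _ => hVle0 i) hVsum) i (Finset.mem_univ i))
    simp [hVzero, ← h0] at hnorm₀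
  · refine ⟨fun i => s₀⁻¹ • V i, fun i => ?_, s₀⁻¹ • z₀, ?_, ?_⟩
    · refine (hρ i).monetary.isClosed_acceptanceSet.mem_of_tendsto
        ((hs₂.inv₀ h0.ne').smul (hV i)) (Eventually.of_forall fun k => ?_)
      rw [inv_smul_smul₀ (hspos _).ne']
      exact hBacc _ _
    · rw [← Finset.smul_sum, Submodule.coe_smul, ← smul_add, hsum₀, inv_smul_smul₀ h0.ne']
    · rw [Submodule.coe_smul, map_smul, smul_eq_mul, inv_mul_le_iff₀ h0]
      exact hprice₀

lemma capitalRequirement_le {A : Set (Linf P)} {S : Submodule ℝ (Linf P)} {p : S →ₗ[ℝ] ℝ}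
    {X : Linf P} {Z : S} (h : X - (Z : Linf P) ∈ A) :
    capitalRequirement A S p X ≤ ((p Z : ℝ) : EReal) :=
  iInf₂_le Z h

lemma coe_sub_le_capitalRequirement {A : Set (Linf P)} {S : Submodule ℝ (Linf P)}
    {p : S →ₗ[ℝ] ℝ} {φ : Linf P →L[ℝ] ℝ} (hp : ∀ Z : S, p Z = φ Z) {C : ℝ}
    (hC : ∀ Y ∈ A, φ Y ≤ C) (X : Linf P) :
    ((φ X - C : ℝ) : EReal) ≤ capitalRequirement A S p X := by
  refine le_iInf₂ fun Z hZ => EReal.coe_le_coe_iff.2 ?_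
  have := hC _ hZ
  rw [map_sub, ← hp] at this
  linarith

lemma ereal_sum_ne_bot {ι : Type*} (s : Finset ι) {f : ι → EReal} (hf : ∀ i, f i ≠ ⊥) :
    ∑ i ∈ s, f i ≠ ⊥ :=
  Finset.sum_induction f (· ≠ ⊥) (fun _ _ ha hb => EReal.add_ne_bot_iff.2 ⟨ha, hb⟩)
    (EReal.bot_ne_zero.symm) fun i _ => hf i

lemma ereal_ne_top_of_sum_ne_top {ι : Type*} {s : Finset ι} {f : ι → EReal} (hf : ∀ i, f i ≠ ⊥)
    (h : ∑ i ∈ s, f i ≠ ⊤) {i : ι} (hi : i ∈ s) : f i ≠ ⊤ := by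
  classical
  intro hfi
  rw [← Finset.add_sum_erase s f hi, hfi, EReal.top_add_of_ne_bot (ereal_sum_ne_bot _ hf)] at h
  exact h rfl

lemma ereal_coe_finset_sum {ι : Type*} (s : Finset ι) (f : ι → ℝ) :
    ((∑ i ∈ s, f i : ℝ) : EReal) = ∑ i ∈ s, (f i : EReal) :=
  map_sum (⟨⟨Real.toEReal, EReal.coe_zero⟩, EReal.coe_add⟩ : ℝ →+ EReal) f s

end Sharing

end RiskSharing

open RiskSharing

/-! ### Optimal allocations -/

theorem mainTheorem2 {Ω : Type*} [MeasurableSpace Ω] (P : Measure Ω) [IsProbabilityMeasure P]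
    (hP : IsAtomless P) {n : ℕ}
    -- reference measures equivalent to `P`, with simple densities
    (Q : Fin n → Measure Ω) [∀ i, IsProbabilityMeasure (Q i)]
    (hQP : ∀ i, Q i ≪ P) (hPQ : ∀ i, P ≪ Q i) (hQ : ∀ i, HasSimpleDensity P (Q i))
    -- consistent risk measures and risk measurement regimes
    (ρ : Fin n → Linf P → ℝ) (hρ : ∀ i, IsConsistentRiskMeasure (Q i) (ρ i))
    (S : Fin n → Submodule ℝ (Linf P)) (p : ∀ i, S i →ₗ[ℝ] ℝ)
    (hR : ∀ i, IsRiskMeasurementRegime (acceptanceSet (ρ i)) (S i) (p i))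
    -- the capital requirements and their infimal convolution
    (η : Fin n → Linf P → EReal)
    (hη : ∀ i, η i = capitalRequirement (acceptanceSet (ρ i)) (S i) (p i))
    -- a common compatible density that gives all prices
    (Qstar : Lp ℝ 1 P) (hQstar : ∀ i, Qstar ∈ compatibleSet (ρ i))
    (hprice : ∀ (i : Fin n) (Z : S i), p i Z = ∫ ω, Qstar ω * (Z : Linf P) ω ∂P)
    -- securities of total price one
    (U : ∀ i, S i) (hU : globalPrice S Qstar (totalSecurity U) = 1)
    (X : Linf P) (hX : ∃ Y ∈ allocations n X, ∀ i, Y i ∈ dom (η i)) :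
    ∃ r : ℝ, infConvolution η X = (r : EReal) ∧
      ∃ (N : ∀ i, S i) (A : Fin n → Linf P),
        totalSecurity N ∈ LinearMap.ker (globalPrice S Qstar) ∧
        (∀ i, A i ∈ acceptanceSet (ρ i)) ∧
        (fun i => A i + (N i : Linf P) + r • (U i : Linf P)) ∈ allocations n X ∧
        infConvolution η X = ∑ i, η i (A i + (N i : Linf P) + r • (U i : Linf P)) := by
  choose f hf using hQ
  let D : SimpleFunc Ω (Fin n → ℝ) := ⟨fun ω i => f i ω,
    fun x => (measurable_pi_iff.2 fun i => (f i).measurable) (measurableSet_singleton x),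
    (Set.Finite.pi' fun i => (f i).finite_range).subset <| by
      rintro _ ⟨ω, rfl⟩ i
      exact ⟨ω, rfl⟩⟩
  set φ : Linf P →L[ℝ] ℝ := densityFunctional Qstar with hφ
  have hp : ∀ (i : Fin n) (Z : S i), p i Z = φ Z := fun i Z => by
    rw [hprice, hφ, densityFunctional_apply]
  have hbdd : ∀ i, ∃ C : ℝ, ∀ Y ∈ acceptanceSet (ρ i), φ Y ≤ C := fun i =>
    exists_bound_of_conjugate_lt_top (hQstar i).1
  have hcone : ∀ i, ∀ V ∈ asymptoticCone (acceptanceSet (ρ i)), φ V = 0 → V = 0 :=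
    fun i V hV h0 => (hQstar i).2 V hV (by rwa [← densityFunctional_apply])
  choose C hC using hbdd
  have hlow : ∀ i Y, ((φ Y - C i : ℝ) : EReal) ≤ η i Y := fun i Y => by
    rw [hη i]
    exact coe_sub_le_capitalRequirement (hp i) (hC i) Y
  have hbot : ∀ i Y, η i Y ≠ ⊥ := fun i Y =>
    ((EReal.bot_lt_coe _).trans_le (hlow i Y)).ne'
  -- the infimal convolution is finite: compatibility bounds it below, the allocation `hX` above
  obtain ⟨r, hr⟩ : ∃ r : ℝ, infConvolution η X = (r : EReal) := by
    refine ⟨_, (EReal.coe_toReal ?_ ?_).symm⟩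
    · obtain ⟨Y, hYX, hY⟩ := hX
      choose y hy using hY
      refine ((iInf₂_le Y hYX).trans_lt ?_).ne
      rw [Finset.sum_congr rfl fun i _ => hy i, ← ereal_coe_finset_sum]
      exact EReal.coe_lt_top _
    · refine ((EReal.bot_lt_coe (φ X - ∑ i, C i)).trans_le (le_iInf₂ fun Y hY => ?_)).ne'
      have hYX : ∑ i, Y i = X := hY
      rw [← hYX, map_sum, ← Finset.sum_sub_distrib, ereal_coe_finset_sum]
      exact Finset.sum_le_sum fun i _ => hlow i (Y i)
  have hcap : ∀ (i : Fin n) (B : Linf P) (Z : S i), B ∈ acceptanceSet (ρ i) →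
      η i (B + (Z : Linf P)) ≤ ((p i Z : ℝ) : EReal) := fun i B Z hB => by
    rw [hη i]
    exact capitalRequirement_le (by rwa [add_sub_cancel_right])
  have hfin : ∀ i, FiniteDimensional ℝ (S i) := fun i => (hR i).finiteDimensional
  have hφtot : ∀ Z : ∀ i, S i, φ (totalSecurity Z : globalMarket S) = ∑ i, p i (Z i) := fun Z => by
    rw [coe_totalSecurity, map_sum]
    exact Finset.sum_congr rfl fun i _ => (hp i (Z i)).symm
  obtain ⟨A, hA, Z, hAZ, hZ⟩ := exists_acceptable_decomposition hQP (D := D) hf hρ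
    (globalMarket S) φ (fun i => ⟨C i, hC i⟩) hcone X r fun ε hε => by
      have hlt : infConvolution η X < ((r + ε : ℝ) : EReal) := by
        rw [hr]
        exact EReal.coe_lt_coe_iff.2 (by linarith)
      obtain ⟨Y, hY⟩ := iInf_lt_iff.1 hlt
      obtain ⟨hYX, hY⟩ := iInf_lt_iff.1 hY
      have hYX' : ∑ i, Y i = X := hYX
      have hy : ∀ i, η i (Y i) = ((η i (Y i)).toReal : EReal) := fun i =>
        (EReal.coe_toReal (ereal_ne_top_of_sum_ne_top (fun i => hbot i (Y i))
          (hY.trans (EReal.coe_lt_top _)).ne (Finset.mem_univ i)) (hbot i (Y i))).symm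
      -- the slack is split evenly among the agents, with one share to spare
      have hgap : ∑ i, (η i (Y i)).toReal < r + ε := by
        rw [Finset.sum_congr rfl fun i _ => hy i, ← ereal_coe_finset_sum] at hY
        exact EReal.coe_lt_coe_iff.1 hY
      set g : ℝ := (r + ε - ∑ i, (η i (Y i)).toReal) / (n + 1) with hg
      have hgpos : 0 < g := div_pos (by linarith) (by positivity)
      have hng : n * g ≤ r + ε - ∑ i, (η i (Y i)).toReal := by
        have : (n + 1) * g = r + ε - ∑ i, (η i (Y i)).toReal := by
          rw [hg]
          field_simp
        linarith
      have hex : ∀ i, ∃ Z : S i, Y i - (Z : Linf P) ∈ acceptanceSet (ρ i) ∧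
          p i Z < (η i (Y i)).toReal + g := fun i => by
        have h1 : η i (Y i) < (((η i (Y i)).toReal + g : ℝ) : EReal) := by
          rw [hy i]
          exact EReal.coe_lt_coe_iff.2 (by simpa using hgpos)
        nth_rewrite 1 [hη i] at h1
        obtain ⟨Z, hZ⟩ := iInf_lt_iff.1 h1
        obtain ⟨hZ1, hZ2⟩ := iInf_lt_iff.1 hZ
        exact ⟨Z, hZ1, EReal.coe_lt_coe_iff.1 hZ2⟩
      choose Z hZ1 hZ2 using hex
      refine ⟨fun i => Y i - (Z i : Linf P), hZ1, totalSecurity Z, ?_, ?_⟩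
      · rw [coe_totalSecurity, ← Finset.sum_add_distrib]
        simpa using hYX'
      · rw [hφtot]
        have := Finset.sum_le_sum fun i (_ : i ∈ Finset.univ) => (hZ2 i).le
        rw [Finset.sum_add_distrib, Finset.sum_const, Finset.card_univ, Fintype.card_fin,
          nsmul_eq_mul] at this
        linarith
  obtain ⟨z, hzS, hzZ⟩ := (Submodule.mem_iSup_iff_exists_finsupp S Z).1 Z.2
  rw [Finsupp.sum_fintype _ _ fun _ => rfl] at hzZ
  let T : ∀ i, S i := fun i => ⟨z i, hzS i⟩
  have hTZ : totalSecurity T = Z := Subtype.ext ((coe_totalSecurity T).trans hzZ)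
  have hTr : ∑ i, p i (T i) ≤ r := by rwa [← hφtot, hTZ]
  have halloc : (fun i => A i + (T i : Linf P)) ∈ allocations n X := by
    change ∑ i, (A i + (T i : Linf P)) = X
    rw [Finset.sum_add_distrib, ← coe_totalSecurity, hTZ, hAZ]
  have hle : infConvolution η X ≤ ∑ i, η i (A i + (T i : Linf P)) := iInf₂_le _ halloc
  have hge : ∑ i, η i (A i + (T i : Linf P)) ≤ ((∑ i, p i (T i) : ℝ) : EReal) := by
    rw [ereal_coe_finset_sum]
    exact Finset.sum_le_sum fun i _ => hcap i (A i) (T i) (hA i)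
  have hrT : r = ∑ i, p i (T i) := by
    refine le_antisymm (EReal.coe_le_coe_iff.1 ?_) hTr
    rw [← hr]
    exact hle.trans hge
  have hUsum : ∑ i, p i (U i) = 1 := by rw [← hφtot, ← hU]; rfl
  -- shifting the securities by `r • U` leaves a vector of total price zero
  have hN : ∀ i, A i + ((T i - r • U i : S i) : Linf P) + r • (U i : Linf P) =
      A i + (T i : Linf P) := fun i => by
    rw [Submodule.coe_sub, Submodule.coe_smul]
    abel
  refine ⟨r, hr, fun i => T i - r • U i, A, ?_, hA, ?_, ?_⟩
  · rw [LinearMap.mem_ker]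
    refine (hφtot fun i => T i - r • U i).trans ?_
    simp only [map_sub, map_smul, smul_eq_mul]
    rw [Finset.sum_sub_distrib, ← Finset.mul_sum, hUsum, ← hrT, mul_one, sub_self]
  · simpa only [hN] using halloc
  · simp only [hN]
    refine le_antisymm hle (hge.trans_eq ?_)
    rw [← hrT, hr]
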